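/- Let $\mu$ be the unique Borel probability measure on $\mathbb R$ satisfying $\mu(E)=\tfrac12\bigl(\mu(\tau_0^{-1}E)+\mu(\tau_2^{-1}E)\bigr)$ for all Borel sets $E\subset\mathbb R$, where $\tau_0(x)=x/4$ and $\tau_2(x)=(x+2)/4$. An odd number $m\in\mathbb N$ is called *complete* if, with $$\Gamma(m)=\Bigl\{\sum_{k=0}^n 4^k l_k : l_k\in\{0,m\},\ n\in\mathbb N\Bigr\},$$ the family of exponential functions $x\mapsto e^{2\pi i\lambda x}$, $\lambda\in\Gamma(m)$, is an orthonormal basis of $L^2(\mu)$. For odd $m\ge 1$ let $o_4(m)$ be the smallest positive integer $a$ with $4^a\equiv 1 \pmod m$, and for an odd prime $p$ let $\iota_4(p)$ be the largest integer $l$ with $o_4(p^l)=o_4(p)$. Theorem. Let $p_1,\dots,p_r$ be distinct odd primes. For $i\in\{1,\dots,r\}$, let $j_i\ge 0$ be the largest integer such that $p_i^{j_i}$ divides $\operatorname{lcm}(o_4(p_1),\dots,o_4(p_r))$. Assume that $p_1^{\iota_4(p_1)+j_1}\cdots p_r^{\iota_4(p_r)+j_r}$ is complete. Then $p_1^{k_1}\cdots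 p_r^{k_r}$ is complete for all integers $k_1,\dots,k_r\ge 0$. -/

import Mathlib

open MeasureTheory

noncomputable section

namespace CantorFourier

/-- The contraction `τ_d(x) = (x + d) / 4`; the Cantor set is built from `τ_0` and `τ_2`. -/
def tau (d x : ℝ) : ℝ := (x + d) / 4

/-- The fair coin on `Bool`. -/
def coin : Measure Bool :=
  (1 / 2 : ENNReal) • Measure.dirac false + (1 / 2 : ENNReal) • Measure.dirac true

instance : IsProbabilityMeasure coin := ⟨by
  simp [coin, ENNReal.inv_two_add_inv_two]⟩

/-- The digit in `{0, 2}` coded by a bit. -/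
def digit (b : Bool) : ℝ := if b then 2 else 0

/-- The point `∑_{k ≥ 1} 4^{-k} b_k` of the Cantor set with base-4 digits `b_k ∈ {0, 2}`. -/
def cantorPoint (b : ℕ → Bool) : ℝ := ∑' k, digit (b k) / 4 ^ (k + 1)

/-- The Jorgensen–Pedersen measure on the Cantor set: the law of `∑_{k ≥ 1} 4^{-k} b_k` with
independent digits `b_k` that are `0` or `2` with probability `1/2` each. By
`cantorMeasure_invariant` and `eq_cantorMeasure` below it is the unique Borel
probability measure that is invariant under the iterated function system `τ_0, τ_2`. -/
def cantorMeasure : Measure ℝ :=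
  (Measure.infinitePi (fun _ : ℕ => coin)).map cantorPoint

/-- `μ(E) = (μ(τ_0⁻¹ E) + μ(τ_2⁻¹ E)) / 2` for all Borel sets `E`. -/
def IsInvariant (μ : Measure ℝ) : Prop :=
  ∀ E : Set ℝ, MeasurableSet E → μ E = 1 / 2 * (μ (tau 0 ⁻¹' E) + μ (tau 2 ⁻¹' E))

lemma summable_digit (b : ℕ → Bool) : Summable fun k => digit (b k) / 4 ^ (k + 1) := by
  have h : Summable fun k : ℕ => (2 : ℝ) * (1 / 4) ^ k :=
    (summable_geometric_of_lt_one (by norm_num) (by norm_num)).mul_left 2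
  refine Summable.of_nonneg_of_le (fun k => ?_) (fun k => ?_) h
  · unfold digit; split <;> positivity
  · unfold digit
    rw [one_div, inv_pow, ← div_eq_mul_inv]
    split
    · gcongr <;> norm_num
    · rw [zero_div]; positivity

lemma measurable_cantorPoint : Measurable cantorPoint := by
  unfold cantorPoint
  refine Measurable.tsum (fun k => ?_)
  exact ((measurable_of_finite digit).comp (measurable_pi_apply k)).div_const _

instance : IsProbabilityMeasure cantorMeasure :=
  Measure.isProbabilityMeasure_map measurable_cantorPoint.aemeasurable

/-- Prepend a bit to a sequence. -/
def consBit (a : Bool) (b : ℕ → Bool) : ℕ → Bool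
  | 0 => a
  | k + 1 => b k

lemma measurable_consBit (a : Bool) : Measurable (consBit a) := by
  refine measurable_pi_iff.2 fun k => ?_
  cases k with
  | zero => exact measurable_const
  | succ k => exact measurable_pi_apply k

lemma cantorPoint_consBit (a : Bool) (b : ℕ → Bool) :
    cantorPoint (consBit a b) = tau (digit a) (cantorPoint b) := by
  unfold cantorPoint tau
  rw [(summable_digit _).tsum_eq_zero_add]
  have : ∀ k, digit (consBit a b (k + 1)) / 4 ^ (k + 1 + 1)
      = digit (b k) / 4 ^ (k + 1) / 4 := fun k => by
    simp only [consBit]; rw [pow_succ _ (k + 1), div_div]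
  rw [tsum_congr this, tsum_div_const]
  simp only [consBit]
  ring

lemma infinitePi_coin : Measure.infinitePi (fun _ : ℕ => coin) =
    (1 / 2 : ENNReal) • (Measure.infinitePi (fun _ : ℕ => coin)).map (consBit false) +
    (1 / 2 : ENNReal) • (Measure.infinitePi (fun _ : ℕ => coin)).map (consBit true) := by
  symm
  refine Measure.eq_infinitePi _ fun s t _ => ?_
  classical
  obtain ⟨N, hN⟩ : ∃ N, s ⊆ Finset.range (N + 1) := by
    obtain ⟨N, h⟩ := s.exists_nat_subset_range
    exact ⟨N, h.trans (Finset.range_mono N.le_succ)⟩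
  set t' : ℕ → Set Bool := fun i => if i ∈ s then t i else Set.univ with ht'
  have hpi : Set.pi (s : Set ℕ) t = Set.pi (Finset.range (N + 1) : Set ℕ) t' := by
    ext x
    simp only [Set.mem_pi, Finset.mem_coe, ht']
    refine ⟨fun h i _ => ?_, fun h i hi => ?_⟩
    · split
      · exact h i ‹_›
      · trivial
    · simpa [hi] using h i (hN hi)
  have hprod : ∏ i ∈ s, coin (t i) = ∏ i ∈ Finset.range (N + 1), coin (t' i) := by
    rw [← Finset.prod_subset hN (fun i _ hi => by
      simp only [ht', if_neg hi]; exact measure_univ)]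
    exact Finset.prod_congr rfl fun i hi => by simp [ht', hi]
  have key : ∀ a, (Measure.infinitePi (fun _ : ℕ => coin)).map (consBit a)
      (Set.pi (Finset.range (N + 1) : Set ℕ) t') =
      Measure.dirac a (t' 0) * ∏ i ∈ Finset.range N, coin (t' (i + 1)) := by
    intro a
    rw [Measure.map_apply (measurable_consBit a)
      (MeasurableSet.pi (Finset.countable_toSet _) fun i _ => Set.Finite.measurableSet
        (Set.toFinite _))]
    by_cases ha : a ∈ t' 0
    · have : consBit a ⁻¹' (Set.pi (Finset.range (N + 1) : Set ℕ) t') =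
          Set.pi (Finset.range N : Set ℕ) fun i => t' (i + 1) := by
        ext x
        simp only [Set.mem_preimage, Set.mem_pi, Finset.mem_coe, Finset.mem_range]
        refine ⟨fun h i hi => h (i + 1) (by omega), fun h i hi => ?_⟩
        cases i with
        | zero => exact ha
        | succ i => exact h i (by omega)
      rw [this, Measure.infinitePi_pi _ fun i _ => Set.Finite.measurableSet (Set.toFinite _)]
      simp [ha]
    · have : consBit a ⁻¹' (Set.pi (Finset.range (N + 1) : Set ℕ) t') = ∅ := by
        ext x
        simp only [Set.mem_preimage, Set.mem_pi, Finset.mem_coe, Finset.mem_range,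
          Set.mem_empty_iff_false, iff_false]
        exact fun h => ha (h 0 (by omega))
      rw [this, measure_empty, Measure.dirac_apply, Set.indicator_of_notMem ha, zero_mul]
  rw [hpi, hprod, Finset.prod_range_succ', Measure.add_apply, Measure.smul_apply,
    Measure.smul_apply, key, key, coin, Measure.add_apply, Measure.smul_apply,
    Measure.smul_apply]
  simp only [smul_eq_mul]
  ring

theorem cantorMeasure_invariant : IsInvariant cantorMeasure := by
  intro E hE
  have hm : ∀ d, Measurable (tau d) := fun d => by unfold tau; fun_prop
  have h : ∀ a : Bool, (Measure.infinitePi (fun _ : ℕ => coin)).map (consBit a)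
      (cantorPoint ⁻¹' E) = cantorMeasure (tau (digit a) ⁻¹' E) := by
    intro a
    rw [Measure.map_apply (measurable_consBit a) (measurable_cantorPoint hE), cantorMeasure,
      Measure.map_apply measurable_cantorPoint (hm _ hE)]
    congr 1
    ext b
    simp [cantorPoint_consBit]
  have h0 := h false
  have h2 := h true
  simp only [digit, Bool.false_eq_true, if_false, if_true] at h0 h2
  conv_lhs => rw [cantorMeasure, Measure.map_apply measurable_cantorPoint hE, infinitePi_coin]
  rw [Measure.add_apply, Measure.smul_apply, Measure.smul_apply, h0, h2, smul_eq_mul,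
    smul_eq_mul, mul_add]

lemma IsInvariant.charFun_eq {μ : Measure ℝ} [IsProbabilityMeasure μ] (h : IsInvariant μ)
    (t : ℝ) : charFun μ t =
      (1 + Complex.exp ((t / 2 : ℝ) * Complex.I)) / 2 * charFun μ (t / 4) := by
  have hm : ∀ d, Measurable (tau d) := fun d => by unfold tau; fun_prop
  have hμ : μ = (1 / 2 : ENNReal) • μ.map (tau 0) + (1 / 2 : ENNReal) • μ.map (tau 2) := by
    ext E hE
    rw [h E hE, Measure.add_apply, Measure.smul_apply, Measure.smul_apply,
      Measure.map_apply (hm 0) hE, Measure.map_apply (hm 2) hE, smul_eq_mul, smul_eq_mul, mul_add]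
  have hi : ∀ (ν : Measure ℝ) [IsFiniteMeasure ν],
      Integrable (fun x : ℝ => Complex.exp (t * x * Complex.I)) ν := by
    intro ν _
    refine Integrable.of_bound (C := 1) (by fun_prop) (Filter.Eventually.of_forall fun x => ?_)
    have := Complex.norm_exp_ofReal_mul_I (t * x)
    push_cast at this
    exact this.le
  have hd : ∀ d : ℝ, ∫ x, Complex.exp (t * x * Complex.I) ∂(μ.map (tau d)) =
      Complex.exp ((t * d / 4 : ℝ) * Complex.I) * charFun μ (t / 4) := by
    intro d
    rw [integral_map (hm d).aemeasurable (by fun_prop), charFun_apply_real,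
      ← integral_const_mul]
    congr 1
    ext x
    rw [← Complex.exp_add]
    congr 1
    simp only [tau]
    push_cast
    ring
  have := (Measure.isProbabilityMeasure_map (μ := μ) (hm 0).aemeasurable)
  have := (Measure.isProbabilityMeasure_map (μ := μ) (hm 2).aemeasurable)
  conv_lhs => rw [charFun_apply_real, hμ]
  rw [integral_add_measure ((hi _).smul_measure (by simp)) ((hi _).smul_measure (by simp)),
    integral_smul_measure, integral_smul_measure, hd, hd]
  have e : t * 2 / 4 = t / 2 := by ring
  rw [e]
  simp
  ring

/-- The invariance equation determines the Borel probability measure. -/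
theorem eq_cantorMeasure {μ : Measure ℝ} [IsProbabilityMeasure μ] (h : IsInvariant μ) :
    μ = cantorMeasure := by
  refine Measure.ext_of_charFun (funext fun t => ?_)
  set f : ℝ → ℂ := fun t => charFun μ t - charFun cantorMeasure t with hf
  have hle : ∀ s, ‖f s‖ ≤ ‖f (s / 4)‖ := by
    intro s
    have : f s = (1 + Complex.exp ((s / 2 : ℝ) * Complex.I)) / 2 * f (s / 4) := by
      simp only [hf]
      rw [h.charFun_eq s, cantorMeasure_invariant.charFun_eq s]
      ring
    rw [this, norm_mul]
    refine mul_le_of_le_one_left (norm_nonneg _) ?_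
    rw [norm_div]
    have h1 := norm_add_le 1 (Complex.exp ((s / 2 : ℝ) * Complex.I))
    rw [Complex.norm_exp_ofReal_mul_I, norm_one] at h1
    rw [Complex.norm_ofNat, div_le_one (by norm_num)]
    linarith
  have hn : ∀ n : ℕ, ‖f t‖ ≤ ‖f (t * (1 / 4) ^ n)‖ := by
    intro n
    induction n with
    | zero => simp
    | succ n ih =>
      refine ih.trans ((hle _).trans_eq ?_)
      rw [pow_succ]
      congr 2
      ring
  have hc : Continuous f := by
    have hcont : ∀ (ν : Measure ℝ) [IsProbabilityMeasure ν], Continuous (charFun ν) := by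
      intro ν _
      have : charFun ν = fun t : ℝ => ∫ x : ℝ, Complex.exp (t * x * Complex.I) ∂ν := by
        ext t; exact charFun_apply_real t
      rw [this]
      refine continuous_of_dominated (bound := fun _ => 1) (fun t => by fun_prop)
        (fun t => Filter.Eventually.of_forall fun x => ?_) (integrable_const _)
        (Filter.Eventually.of_forall fun x => by fun_prop)
      have := Complex.norm_exp_ofReal_mul_I (t * x)
      push_cast at this
      exact this.le
    exact (hcont μ).sub (hcont cantorMeasure)
  have h0 : f 0 = 0 := by simp [hf]
  have hlim : Filter.Tendsto (fun n : ℕ => ‖f (t * (1 / 4) ^ n)‖) Filter.atTop (nhds 0) := by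
    have h1 : Filter.Tendsto (fun n : ℕ => t * (1 / 4 : ℝ) ^ n) Filter.atTop (nhds 0) := by
      simpa using (tendsto_pow_atTop_nhds_zero_of_lt_one (r := (1 / 4 : ℝ)) (by norm_num)
        (by norm_num)).const_mul t
    simpa [h0] using ((hc.tendsto 0).comp h1).norm
  have : ‖f t‖ ≤ 0 := ge_of_tendsto' hlim hn
  exact sub_eq_zero.1 (norm_le_zero_iff.1 this)

/-- `Γ` is a spectrum for `μ`: the family of exponentials `e_lam(x) = e^{2πi lam x}`, `lam ∈ Γ`,
is an orthonormal (Hilbert) basis of `L²(μ)`. -/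
def IsSpectrum (Γ : Set ℝ) (μ : Measure ℝ) : Prop :=
  ∃ b : HilbertBasis Γ ℂ (Lp ℂ 2 μ),
    ∀ lam : Γ, b lam =ᵐ[μ] fun x : ℝ => Complex.exp (2 * Real.pi * Complex.I * (lam : ℝ) * x)

/-- `Γ(m) = {∑_{k=0}^n 4^k l_k : l_k ∈ {0, m}, n ∈ ℕ}`. -/
def Gam (m : ℕ) : Set ℝ :=
  {x | ∃ (n : ℕ) (l : ℕ → ℝ), (∀ k, l k = 0 ∨ l k = m) ∧
    x = ∑ k ∈ Finset.range (n + 1), 4 ^ k * l k}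

/-- The (odd) number `m` is complete: `Γ(m)` is a spectrum for the Cantor measure. -/
def IsCompleteNumber (m : ℕ) : Prop := IsSpectrum (Gam m) cantorMeasure

/-- `o_4(m)`: the order of `4` modulo the odd number `m`. -/
def o4 (m : ℕ) : ℕ := orderOf (4 : ZMod m)

/-- `ι_4(p)`: the largest `l` such that `o_4(p^l) = o_4(p)`; see `isGreatest_iota4`. -/
def iota4 (p : ℕ) : ℕ := sSup {l : ℕ | o4 (p ^ l) = o4 p}

lemma o4_pos {m : ℕ} (hm : Odd m) : 0 < o4 m := by
  have : NeZero m := ⟨hm.pos.ne'⟩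
  have hc : Nat.Coprime 4 m := by
    have : Nat.Coprime (2 ^ 2) m := (Nat.coprime_two_left.2 hm).pow_left 2
    simpa using this
  have h := orderOf_pos (ZMod.unitOfCoprime 4 hc)
  rw [← orderOf_units] at h
  simpa [o4] using h

/-- For odd `p > 1` the supremum defining `ι_4(p)` is a maximum. -/
theorem isGreatest_iota4 {p : ℕ} (hp : Odd p) (h1 : 1 < p) :
    IsGreatest {l : ℕ | o4 (p ^ l) = o4 p} (iota4 p) := by
  have hne : {l : ℕ | o4 (p ^ l) = o4 p}.Nonempty := ⟨1, by simp⟩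
  have hb : BddAbove {l : ℕ | o4 (p ^ l) = o4 p} := by
    refine ⟨4 ^ o4 p - 1, fun l hl => ?_⟩
    have h4 : (4 : ZMod (p ^ l)) ^ o4 p = 1 := by
      rw [← (hl : o4 (p ^ l) = o4 p)]; exact pow_orderOf_eq_one _
    have hlt : 1 < 4 ^ o4 p := Nat.one_lt_pow (o4_pos hp).ne' (by norm_num)
    have hdvd : p ^ l ∣ 4 ^ o4 p - 1 := by
      rw [← ZMod.natCast_eq_zero_iff, Nat.cast_sub hlt.le]
      push_cast
      rw [h4, sub_self]
    exact (Nat.lt_pow_self h1).le.trans (Nat.le_of_dvd (by omega) hdvd)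
  exact ⟨Nat.sSup_mem hne hb, fun l hl => le_csSup hb hl⟩

end CantorFourier

end

/-! For odd `m`, completeness is equivalent to the absence of a cycle (`HasCycle`). This reduces the
theorem to divisibility.

Analysis. Let `h t` be the squared norm of the projection of `e_{-t}` onto the closed span of the
`e_γ`, `γ ∈ Γ(m)`. It is real analytic, equals `∑ |μ̂(t + γ)|²`, and is a weighted average of its
values at `t / 4` and `(t + m) / 4`. Its minimizers on `[0, m / 3]` are closed under the transitions
of positive weight. If there are infinitely many, analyticity forces `h = 1` and `Γ(m)` spans; if
finitely many, they produce a cycle (`hasCycle_of_finite`). Conversely, a cycle point `x` gives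
`e_{-x}` orthogonal to every `e_γ` (`cantorFT_cycle_add`).

Arithmetic. Write a cycle in lowest terms `a / d` and let `L` be the lcm of the orders of `4` modulo
the primes. If `p` occurred in `d` more often than in `4 ^ L - 1`, the orbit of `a` would contain a
translate by about half of `d` and so leave `(0, d / 3]`. Hence `d ∣ 4 ^ L - 1` (`dvd_of_cycle`),
and lifting the exponent bounds each valuation of `d` by `ι + j`. So a cycle for any exponents `k`
already gives one for the exponents `ι + j`. -/

noncomputable section

namespace CantorFourier

/-! ### Arithmetic of cycles -/

/-- Some nonzero residue class modulo `m` has its whole orbit under multiplication by `4`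
represented in `(0, m / 3]`. Equivalently, the digit set `{0, m}` has a nontrivial extreme
cycle. -/
def HasCycle (m : ℕ) : Prop := ∃ x : ℕ, ∀ j : ℕ, 0 < 4 ^ j * x % m ∧ 3 * (4 ^ j * x % m) ≤ m

lemma HasCycle.of_dvd {d m : ℕ} (hm : m ≠ 0) (hdm : d ∣ m) (h : HasCycle d) : HasCycle m := by
  obtain ⟨c, rfl⟩ := hdm
  obtain ⟨x, hx⟩ := h
  have hc : 0 < c := Nat.pos_of_ne_zero (right_ne_zero_of_mul hm)
  refine ⟨x * c, fun j => ?_⟩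
  obtain ⟨h1, h2⟩ := hx j
  rw [← mul_assoc, Nat.mul_mod_mul_right, ← mul_assoc]
  exact ⟨Nat.mul_pos h1 hc, Nat.mul_le_mul_right c h2⟩

/-- Cancelling the gcd scales residues and modulus alike, so a cycle lives on the reduced
denominator. -/
lemma HasCycle.exists_coprime {n : ℕ} (hn : n ≠ 0) (h : HasCycle n) :
    ∃ d, d ∣ n ∧ ∃ a : ℕ, a.Coprime d ∧
      ∀ j : ℕ, 0 < 4 ^ j * a % d ∧ 3 * (4 ^ j * a % d) ≤ d := by
  obtain ⟨x, hx⟩ := h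
  obtain ⟨a, d, hcop, ha, hd⟩ := Nat.exists_coprime x n
  have hg : 0 < x.gcd n := Nat.gcd_pos_of_pos_right _ (Nat.pos_of_ne_zero hn)
  refine ⟨d, ⟨_, hd⟩, a, hcop, fun j => ?_⟩
  have := hx j
  generalize x.gcd n = g at *
  subst ha hd
  rw [← mul_assoc, Nat.mul_mod_mul_right, ← mul_assoc] at this
  exact ⟨Nat.pos_of_mul_pos_right this.1, Nat.le_of_mul_le_mul_right this.2 hg⟩

/-- Since `p ∣ q`, the square `q ^ 2` vanishes modulo `p * q`, and only the linear binomial term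
survives. -/
lemma one_add_mul_pow_modEq {p q : ℕ} (hpq : p ∣ q) (t s : ℕ) :
    (1 + q * t) ^ s ≡ 1 + s * t * q [MOD p * q] := by
  induction s with
  | zero => simp [Nat.ModEq]
  | succ s ih =>
    rw [pow_succ]
    refine (ih.mul_right _).trans ?_
    obtain ⟨c, rfl⟩ := hpq
    have : (1 + s * t * (p * c)) * (1 + p * c * t) =
      (1 + (s + 1) * t * (p * c)) + p * (p * c) * (c * s * t ^ 2) := by ring
    rw [this]
    simp [Nat.ModEq]

/-- If `4` generates all of `1 + q ℤ` modulo `p q`, the orbit of a unit leaves `(0, p q / 3]`. -/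
lemma not_cycle_of_orbit {p q a E : ℕ} (hp : p.Prime) (hodd : Odd p) (hpq : p ∣ q) (hq : 0 < q)
    (ha : a.Coprime p) (hE : q ∣ 4 ^ E - 1) (hE' : ¬ p * q ∣ 4 ^ E - 1)
    (h : ∀ j : ℕ, 0 < 4 ^ j * a % (p * q) ∧ 3 * (4 ^ j * a % (p * q)) ≤ p * q) : False := by
  obtain ⟨t, ht⟩ := hE
  have h4 : 4 ^ E = 1 + q * t := by
    have : 0 < 4 ^ E := by positivity
    omega
  have hpt : ¬ p ∣ t := by
    rintro ⟨c, rfl⟩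
    exact hE' ⟨c, by rw [ht]; ring⟩
  obtain ⟨r, hr⟩ := hodd
  have hcop : (t * a).Coprime p :=
    Nat.Coprime.mul_left ((hp.coprime_iff_not_dvd.2 hpt).symm) ha
  obtain ⟨u, -, hu⟩ := Nat.exists_mul_mod_eq_one_of_coprime hcop hp.one_lt
  have hu' : t * a * u ≡ 1 [MOD p] := by rw [Nat.ModEq, hu, Nat.mod_eq_of_lt hp.one_lt]
  -- Raising `4 ^ E` to the power `s` adds `s * t * a * q` to `a`. As `u` inverts `t * a` modulo
  -- `p`, the choice `s = u * r` with `r = (p - 1) / 2` shifts by `r * q`, nearly half the modulus.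
  have key : 4 ^ (E * (u * r)) * a ≡ a % (p * q) + r * q [MOD p * q] := by
    rw [pow_mul, h4]
    refine ((one_add_mul_pow_modEq hpq t (u * r)).mul_right a).trans ?_
    have e : (1 + u * r * t * q) * a = a + (t * a * u * r) * q := by ring
    rw [e]
    refine Nat.ModEq.add (Nat.mod_modEq _ _).symm ?_
    refine Nat.ModEq.mul_right' q ?_
    simpa using hu'.mul_right r
  obtain ⟨h0, h0'⟩ := h 0
  obtain ⟨-, h1⟩ := h (E * (u * r))
  rw [pow_zero, one_mul] at h0 h0'
  have hr1 : 1 ≤ r := by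
    by_contra hlt
    have : p = 1 := by omega
    exact hp.one_lt.ne' this
  have e : p * q = 2 * (r * q) + q := by rw [hr]; ring
  have hrq : q ≤ r * q := Nat.le_mul_of_pos_left q hr1
  -- The shifted residue does not wrap around, yet exceeds a third of the modulus: `3 * r * q ≥ p *
  -- q` and the starting residue is positive.
  rw [key, Nat.mod_eq_of_lt (by omega)] at h1
  omega

/-- Each prime `p` put into the exponent contributes the factor `∑ (x ^ c) ^ i`, which has `p` terms
congruent to `1` modulo `p`. -/
lemma dvd_pow_self_sub_one (c : ℕ) (hc : c ≠ 0) (x : ℤ)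
    (h : ∀ q : ℕ, q.Prime → q ∣ c → (q : ℤ) ∣ x - 1) : (c : ℤ) ∣ x ^ c - 1 := by
  induction c using induction_on_primes generalizing x with
  | zero => exact absurd rfl hc
  | one => simp
  | prime_mul p c hp ih =>
    have h1 := ih (right_ne_zero_of_mul hc) x fun q hq hqc => h q hq (hqc.mul_left p)
    have h2 : (p : ℤ) ∣ x ^ c - 1 :=
      (h p hp (dvd_mul_right p c)).trans (sub_one_dvd_pow_sub_one x c)
    rw [mul_comm p c, pow_mul, ← mul_geom_sum, Nat.cast_mul]
    refine mul_dvd_mul h1 ?_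
    rw [← Int.modEq_zero_iff_dvd]
    have h3 : x ^ c ≡ 1 [ZMOD p] := ((Int.modEq_iff_dvd.2 h2)).symm
    calc ∑ i ∈ Finset.range p, (x ^ c) ^ i ≡ ∑ i ∈ Finset.range p, 1 [ZMOD p] := by
          refine Int.ModEq.sum fun i _ => ?_
          simpa using h3.pow i
      _ ≡ 0 [ZMOD p] := by simp [Int.ModEq]

lemma one_le_four_pow (n : ℕ) : 1 ≤ 4 ^ n := Nat.one_le_pow _ _ (by norm_num)

/-- The denominator of a cycle divides `4 ^ L - 1` as soon as its prime factors do. -/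
lemma dvd_of_cycle {d a L : ℕ} (hd : Odd d) (hL : L ≠ 0) (ha : a.Coprime d)
    (h : ∀ j : ℕ, 0 < 4 ^ j * a % d ∧ 3 * (4 ^ j * a % d) ≤ d)
    (hprime : ∀ q : ℕ, q.Prime → q ∣ d → q ∣ 4 ^ L - 1) : d ∣ 4 ^ L - 1 := by
  have h4 : 1 < 4 ^ L := Nat.one_lt_pow hL (by norm_num)
  have hd0 : d ≠ 0 := hd.pos.ne'
  rw [← Nat.factorization_prime_le_iff_dvd hd0 (by omega)]
  intro p hp
  by_contra! hlt
  have : Fact p.Prime := ⟨hp⟩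
  have hpd : p ∣ d := Nat.dvd_of_factorization_pos (by omega)
  have hpodd : Odd p := hd.of_dvd_nat hpd
  set v := d.factorization p with hv
  set w := (4 ^ L - 1).factorization p with hw
  have hw1 : 1 ≤ w := hp.factorization_pos_of_dvd (by omega) (hprime p hp hpd)
  set c := d / p ^ v with hc
  have hdc : p ^ v * c = d := Nat.ordProj_mul_ordCompl_eq_self d p
  have hpc : ¬ p ∣ c := Nat.not_dvd_ordCompl hp hd0
  have hc0 : c ≠ 0 := by rintro h0; simp [h0] at hpc
  -- The factor `c` secures `c ∣ 4 ^ E - 1`; the power of `p` raises the `p`-adic valuation from `w`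
  -- to exactly `v - 1`. Thus `d / p` divides `4 ^ E - 1` but `d` does not.
  set E := L * c * p ^ (v - 1 - w) with hE
  have hcE : c ∣ 4 ^ E - 1 := by
    have h1 : (c : ℤ) ∣ (4 ^ L) ^ c - 1 := by
      refine dvd_pow_self_sub_one c hc0 _ fun q hq hqc => ?_
      have := Int.natCast_dvd_natCast.2 (hprime q hq (hqc.trans ⟨p ^ v, by rw [← hdc, mul_comm]⟩))
      rw [Nat.cast_sub h4.le] at this
      exact_mod_cast this
    have h2 : (c : ℤ) ∣ ((4 ^ E - 1 : ℕ) : ℤ) := by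
      rw [Nat.cast_sub (one_le_four_pow _)]
      push_cast
      rw [hE, pow_mul, pow_mul]
      exact h1.trans (sub_one_dvd_pow_sub_one _ _)
    exact Int.natCast_dvd_natCast.1 h2
  have hvE : padicValNat p (4 ^ E - 1) = v - 1 := by
    have h1 : ¬ p ∣ 4 ^ L := fun hdiv => by
      have := Nat.dvd_sub hdiv (hprime p hp hpd)
      rw [Nat.sub_sub_self h4.le] at this
      exact hp.one_lt.ne' (Nat.dvd_one.1 this)
    have := padicValNat.pow_sub_pow hpodd h4 (hprime p hp hpd) h1
      (n := c * p ^ (v - 1 - w)) (mul_ne_zero hc0 (pow_ne_zero _ hp.ne_zero))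
    rw [one_pow, ← pow_mul, ← mul_assoc, padicValNat.mul hc0 (pow_ne_zero _ hp.ne_zero),
      padicValNat.prime_pow, padicValNat.eq_zero_of_not_dvd hpc,
      ← Nat.factorization_def (4 ^ L - 1) hp, ← hw] at this
    rw [hE, this]
    omega
  have hE0 : 4 ^ E - 1 ≠ 0 := by
    have : 1 < 4 ^ E := Nat.one_lt_pow
      (mul_ne_zero (mul_ne_zero hL hc0) (pow_ne_zero _ hp.ne_zero)) (by norm_num)
    omega
  have hdq : d = p * (p ^ (v - 1) * c) := by
    rw [← mul_assoc, ← pow_succ', Nat.sub_add_cancel (by omega), hdc]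
  refine not_cycle_of_orbit (q := p ^ (v - 1) * c) (a := a) (E := E) hp hpodd ?_ ?_ ?_ ?_ ?_ ?_
  -- Here `v ≥ 2`, because `v > w ≥ 1`.
  · exact (dvd_pow_self p (by omega)).mul_right c
  · have := hp.pos; positivity
  · exact ha.of_dvd_right hpd
  · refine Nat.Coprime.mul_dvd_of_dvd_of_dvd ?_ ?_ hcE
    · exact ((hp.coprime_iff_not_dvd).2 hpc).pow_left _
    · rw [padicValNat_dvd_iff_le hE0, hvE]
  · rw [← hdq]
    intro hdiv
    have : p ^ v ∣ 4 ^ E - 1 := (Dvd.intro _ hdc).trans hdiv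
    rw [padicValNat_dvd_iff_le hE0, hvE] at this
    omega
  · rw [← hdq]; exact h

lemma dvd_four_pow_o4_sub_one (n : ℕ) : n ∣ 4 ^ o4 n - 1 := by
  rw [← ZMod.natCast_eq_zero_iff, Nat.cast_sub (one_le_four_pow _)]
  push_cast
  rw [o4, pow_orderOf_eq_one, sub_self]

lemma o4_dvd_of_dvd {n E : ℕ} (h : n ∣ 4 ^ E - 1) : o4 n ∣ E := by
  rw [← ZMod.natCast_eq_zero_iff, Nat.cast_sub (one_le_four_pow _)] at h
  push_cast at h
  exact orderOf_dvd_of_pow_eq_one (sub_eq_zero.1 h)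

/-- Lifting the exponent from `o4 p` to `L` adds at most the valuation of `L`; at `o4 p` itself, a
valuation above `iota4 p` would contradict the maximality of `iota4 p`. -/
lemma padicValNat_four_pow_sub_one_le {p : ℕ} (hp : p.Prime) (hodd : Odd p) {L : ℕ} (hL : L ≠ 0)
    (h : o4 p ∣ L) : padicValNat p (4 ^ L - 1) ≤ iota4 p + padicValNat p L := by
  have : Fact p.Prime := ⟨hp⟩
  obtain ⟨f, rfl⟩ := h
  have ho : o4 p ≠ 0 := left_ne_zero_of_mul hL
  have hf : f ≠ 0 := right_ne_zero_of_mul hL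
  have h4 : 1 < 4 ^ o4 p := Nat.one_lt_pow ho (by norm_num)
  have h1 : ¬ p ∣ 4 ^ o4 p := fun hdiv => by
    have := (Nat.dvd_sub hdiv (dvd_four_pow_o4_sub_one p))
    rw [Nat.sub_sub_self h4.le] at this
    exact hp.one_lt.ne' (Nat.dvd_one.1 this)
  have e := padicValNat.pow_sub_pow hodd h4 (dvd_four_pow_o4_sub_one p) h1 hf
  rw [one_pow, ← pow_mul] at e
  rw [e, padicValNat.mul ho hf]
  have : padicValNat p (4 ^ o4 p - 1) ≤ iota4 p := by
    by_contra! hlt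
    have hdiv : p ^ (iota4 p + 1) ∣ 4 ^ o4 p - 1 := (padicValNat_dvd_iff_le (by omega)).2 hlt
    have h2 : o4 p ∣ o4 (p ^ (iota4 p + 1)) :=
      o4_dvd_of_dvd ((dvd_pow_self p (by omega)).trans (dvd_four_pow_o4_sub_one _))
    have := (isGreatest_iota4 hodd hp.one_lt).2
      (Nat.dvd_antisymm (o4_dvd_of_dvd hdiv) h2 : o4 (p ^ (iota4 p + 1)) = o4 p)
    omega
  omega

theorem HasCycle.prod_pow {r : ℕ} {p : Fin r → ℕ} (hp : ∀ i, (p i).Prime)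
    (hodd : ∀ i, Odd (p i)) {j : Fin r → ℕ}
    (hj : ∀ i, IsGreatest {n : ℕ | p i ^ n ∣ Finset.univ.lcm fun i' => o4 (p i')} (j i))
    {k : Fin r → ℕ} (h : HasCycle (∏ i, p i ^ k i)) :
    HasCycle (∏ i, p i ^ (iota4 (p i) + j i)) := by
  have hne : ∀ e : Fin r → ℕ, ∏ i, p i ^ e i ≠ 0 := fun e =>
    Finset.prod_ne_zero_iff.2 fun i _ => pow_ne_zero _ (hp i).ne_zero
  obtain ⟨d, hd, a, ha, hcyc⟩ := h.exists_coprime (hne k)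
  have hdodd : Odd d := by
    refine Odd.of_dvd_nat ?_ hd
    exact Finset.prod_induction _ Odd (fun _ _ => Odd.mul) odd_one fun i _ => (hodd i).pow
  set L := Finset.univ.lcm fun i' => o4 (p i') with hL
  have hL0 : L ≠ 0 := by
    intro h0
    obtain ⟨i, -, hi⟩ := Finset.lcm_eq_zero_iff.1 h0
    exact (o4_pos (hodd i)).ne' hi
  have hoL : ∀ i, o4 (p i) ∣ L := fun i => Finset.dvd_lcm (Finset.mem_univ i)
  have hpd : ∀ q : ℕ, q.Prime → q ∣ d → ∃ i, q = p i := by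
    intro q hq hqd
    obtain ⟨i, -, hi⟩ := (Prime.dvd_finsetProd_iff hq.prime _).1 (hqd.trans hd)
    exact ⟨i, (Nat.prime_dvd_prime_iff_eq hq (hp i)).1 (hq.dvd_of_dvd_pow hi)⟩
  have hdL : d ∣ 4 ^ L - 1 := by
    refine dvd_of_cycle hdodd hL0 ha hcyc fun q hq hqd => ?_
    obtain ⟨i, rfl⟩ := hpd q hq hqd
    exact (dvd_four_pow_o4_sub_one _).trans (Nat.pow_sub_one_dvd_pow_sub_one 4 (hoL i))
  refine HasCycle.of_dvd (hne _) ?_ ⟨a, hcyc⟩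
  have hd0 : d ≠ 0 := hdodd.pos.ne'
  have h4 : 1 < 4 ^ L := Nat.one_lt_pow hL0 (by norm_num)
  rw [← Nat.factorization_prime_le_iff_dvd hd0 (hne _)]
  intro q hq
  by_cases hqd : q ∣ d
  swap
  · rw [Nat.factorization_eq_zero_of_not_dvd hqd]; exact Nat.zero_le _
  obtain ⟨i, rfl⟩ := hpd q hq hqd
  have : Fact (p i).Prime := ⟨hq⟩
  have hjL : padicValNat (p i) L ≤ j i := (hj i).2 pow_padicValNat_dvd
  calc d.factorization (p i) ≤ (4 ^ L - 1).factorization (p i) :=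
        (Nat.factorization_le_iff_dvd hd0 (by omega)).2 hdL _
    _ = padicValNat (p i) (4 ^ L - 1) := Nat.factorization_def _ hq
    _ ≤ iota4 (p i) + j i :=
        (padicValNat_four_pow_sub_one_le hq (hodd i) hL0 (hoL i)).trans (by omega)
    _ ≤ _ := (hq.pow_dvd_iff_le_factorization (hne _)).1
        (Finset.dvd_prod_of_mem (fun i => p i ^ (iota4 (p i) + j i)) (Finset.mem_univ i))

/-! ### Exponentials in `L²` and the Fourier transform of the Cantor measure -/

open BoundedContinuousFunction

lemma cantorPoint_mem (b : ℕ → Bool) : cantorPoint b ∈ Set.Icc (0 : ℝ) 1 := by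
  have hg : HasSum (fun k : ℕ => (1 / 2 : ℝ) * (1 / 4) ^ k) ((1 / 2) * (1 - 1 / 4)⁻¹) :=
    (hasSum_geometric_of_lt_one (by norm_num) (by norm_num)).mul_left _
  refine ⟨tsum_nonneg fun k => ?_, ?_⟩
  · unfold digit; split <;> positivity
  · refine (((summable_digit b).tsum_le_tsum (fun k => ?_) hg.summable)).trans ?_
    · rw [one_div_pow, pow_succ]
      have : digit (b k) ≤ 2 := by unfold digit; split <;> norm_num
      have h4 : (0 : ℝ) < 4 ^ k := by positivity
      rw [div_le_iff₀ (by positivity)]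
      field_simp
      linarith
    · rw [hg.tsum_eq]; norm_num

lemma ae_mem_unitInterval : ∀ᵐ x ∂cantorMeasure, x ∈ Set.Icc (0 : ℝ) 1 := by
  rw [cantorMeasure, ae_map_iff measurable_cantorPoint.aemeasurable (p := (· ∈ Set.Icc (0 : ℝ) 1))
    measurableSet_Icc]
  exact Filter.Eventually.of_forall cantorPoint_mem

/-- `x ↦ 2 π i x`, truncated outside `[0, 1]`. -/
def truncPhase : ℝ →ᵇ ℂ :=
  BoundedContinuousFunction.ofNormedAddCommGroup
    (fun x : ℝ => 2 * Real.pi * Complex.I * ((max 0 (min x 1) : ℝ) : ℂ)) (by fun_prop)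
    (2 * Real.pi) (by
      intro x
      have h0 : 0 ≤ max 0 (min x 1) := le_max_left _ _
      have h1 : max 0 (min x 1) ≤ 1 := max_le (by norm_num) (min_le_right _ _)
      simp only [norm_mul, Complex.norm_ofNat, Complex.norm_real, Complex.norm_I, mul_one,
        Real.norm_eq_abs, abs_of_pos Real.pi_pos, abs_of_nonneg h0]
      nlinarith [Real.pi_pos])

/-- The exponential `x ↦ e^{2 π i t x}` as an element of `L²`. -/
def expL2 (t : ℝ) : Lp ℂ 2 cantorMeasure :=
  BoundedContinuousFunction.toLp 2 cantorMeasure ℂ (NormedSpace.exp (t • truncPhase))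

lemma expL2_ae (t : ℝ) :
    expL2 t =ᵐ[cantorMeasure] fun x : ℝ => Complex.exp (2 * Real.pi * Complex.I * t * x) := by
  filter_upwards [BoundedContinuousFunction.coeFn_toLp 2 cantorMeasure ℂ
    (NormedSpace.exp (t • truncPhase)), ae_mem_unitInterval] with x hx hx1
  rw [expL2, hx]
  -- Evaluation at `x` is a continuous ring homomorphism, so it carries the Banach-algebra
  -- exponential to the complex one.
  let ev : (ℝ →ᵇ ℂ) →+* ℂ :=
    { toFun := fun f => f x, map_one' := rfl, map_mul' := fun _ _ => rfl, map_zero' := rfl,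
      map_add' := fun _ _ => rfl }
  have hev : Continuous ev := (BoundedContinuousFunction.evalCLM ℂ x).continuous
  let _ : NormedAlgebra ℚ (ℝ →ᵇ ℂ) := NormedAlgebra.restrictScalars ℚ ℝ _
  have := NormedSpace.map_exp ev hev (t • truncPhase)
  change ev _ = _
  rw [this, ← Complex.exp_eq_exp_ℂ]
  congr 1
  change t • (2 * Real.pi * Complex.I * ((max 0 (min x 1) : ℝ) : ℂ)) = _
  rw [min_eq_left hx1.2, max_eq_right hx1.1, Complex.real_smul]
  ring

/-- The smoothness exponent `⊤` means analytic. This is why the phase is truncated: it becomes an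
element of a Banach algebra, where `exp` is analytic. -/
lemma contDiff_expL2 : ContDiff ℝ ⊤ expL2 := by
  have h1 : ContDiff ℝ ⊤ (NormedSpace.exp : (ℝ →ᵇ ℂ) → (ℝ →ᵇ ℂ)) :=
    contDiff_omega_iff_analyticOnNhd.2 fun x _ => NormedSpace.exp_analytic x
  have h2 : ContDiff ℝ ⊤ fun t : ℝ => t • truncPhase := contDiff_id.smul contDiff_const
  exact ((BoundedContinuousFunction.toLp 2 cantorMeasure ℂ).restrictScalars ℝ).contDiff.comp
    (h1.comp h2)

/-- The Fourier transform of the Cantor measure at frequency `t`. -/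
def cantorFT (t : ℝ) : ℂ := charFun cantorMeasure (2 * Real.pi * t)

lemma cantorFT_zero : cantorFT 0 = 1 := by simp [cantorFT]

lemma cantorFT_eq (t : ℝ) :
    cantorFT t = (1 + Complex.exp ((Real.pi * t : ℝ) * Complex.I)) / 2 * cantorFT (t / 4) := by
  unfold cantorFT
  have e1 : 2 * Real.pi * t / 2 = Real.pi * t := by ring
  have e2 : 2 * Real.pi * t / 4 = 2 * Real.pi * (t / 4) := by ring
  rw [cantorMeasure_invariant.charFun_eq, e1, e2]

lemma inner_expL2 (s t : ℝ) : inner ℂ (expL2 s) (expL2 t) = cantorFT (t - s) := by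
  rw [L2.inner_def, cantorFT, charFun_apply_real]
  refine integral_congr_ae ?_
  filter_upwards [expL2_ae s, expL2_ae t] with x hs ht
  rw [hs, ht, RCLike.inner_apply, ← Complex.exp_conj, ← Complex.exp_add]
  congr 1
  simp only [map_mul, Complex.conj_ofReal, Complex.conj_I, map_ofNat]
  push_cast
  ring

lemma norm_expL2 (t : ℝ) : ‖expL2 t‖ = 1 := by
  have : (‖expL2 t‖ : ℂ) ^ 2 = 1 := by
    rw [← Complex.coe_algebraMap, ← inner_self_eq_norm_sq_to_K (𝕜 := ℂ), inner_expL2, sub_self, cantorFT_zero]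
  have h : ‖expL2 t‖ ^ 2 = 1 := by exact_mod_cast this
  exact (pow_eq_one_iff_of_nonneg (norm_nonneg _) two_ne_zero).1 h

/-- The transform vanishes at `4 ^ k * odd`. -/
lemma cantorFT_odd {n : ℤ} (hn : Odd n) : cantorFT n = 0 := by
  rw [cantorFT_eq]
  obtain ⟨k, rfl⟩ := hn
  have : Complex.exp ((Real.pi * ((2 * k + 1 : ℤ) : ℝ) : ℝ) * Complex.I) = -1 := by
    have e : ((Real.pi * ((2 * k + 1 : ℤ) : ℝ) : ℝ) * Complex.I) =
      Real.pi * Complex.I + k * (2 * Real.pi * Complex.I) := by push_cast; ring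
    rw [e, Complex.exp_add, Complex.exp_pi_mul_I, Complex.exp_int_mul_two_pi_mul_I, mul_one]
  rw [this]
  simp

lemma cantorFT_four_mul {n : ℤ} (h : cantorFT n = 0) : cantorFT ((4 * n : ℤ) : ℝ) = 0 := by
  rw [cantorFT_eq]
  have : ((4 * n : ℤ) : ℝ) / 4 = n := by push_cast; ring
  rw [this, h, mul_zero]

/-! ### Indexing `Γ(m)` and orthonormality -/

/-- `∑ 4^k b_k` for `n = ∑ 2^k b_k`. -/
def spread (n : ℕ) : ℕ := Nat.ofDigits 4 (Nat.digits 2 n)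

lemma spread_zero : spread 0 = 0 := by simp [spread]

lemma spread_two_mul (n : ℕ) : spread (2 * n) = 4 * spread n := by
  rcases Nat.eq_zero_or_pos n with rfl | hn
  · simp [spread]
  · have := Nat.digits_add 2 (by norm_num) 0 n (by norm_num) (Or.inr hn.ne')
    rw [zero_add] at this
    simp [spread, this, Nat.ofDigits_cons]

lemma spread_two_mul_add_one (n : ℕ) : spread (2 * n + 1) = 4 * spread n + 1 := by
  have := Nat.digits_add 2 (by norm_num) 1 n (by norm_num) (Or.inl one_ne_zero)
  rw [add_comm 1] at this
  rw [spread, this, Nat.ofDigits_cons, spread, add_comm]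

/-- With this indexing, removing the lowest base-4 digit of a frequency is halving its index. -/
lemma Gam_eq_range (m : ℕ) : Gam m = Set.range fun n => ((m * spread n : ℕ) : ℝ) := by
  ext x
  constructor
  · rintro ⟨n, l, hl, rfl⟩
    generalize n + 1 = N
    induction N generalizing l with
    | zero => exact ⟨0, by simp [spread_zero]⟩
    | succ N ih =>
      obtain ⟨a, ha⟩ := ih (fun k => l (k + 1)) fun k => hl (k + 1)
      have : ∑ k ∈ Finset.range (N + 1), (4 : ℝ) ^ k * l k = 4 * ((m * spread a : ℕ) : ℝ) + l 0 := by
        simp only [] at ha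
        rw [Finset.sum_range_succ', ha, Finset.mul_sum]
        simp [pow_succ, mul_comm, mul_left_comm]
      rcases hl 0 with h | h
      · refine ⟨2 * a, ?_⟩
        rw [this, h]
        simp only [spread_two_mul]; push_cast; ring
      · refine ⟨2 * a + 1, ?_⟩
        rw [this, h]
        simp only [spread_two_mul_add_one]; push_cast; ring
  · rintro ⟨n, rfl⟩
    induction n using Nat.strong_induction_on with
    | _ n ih =>
      rcases Nat.eq_zero_or_pos n with rfl | hn
      · exact ⟨0, fun _ => 0, fun _ => Or.inl rfl, by simp [spread_zero]⟩
      obtain ⟨N, l, hl, e⟩ := ih (n / 2) (Nat.div_lt_self hn (by norm_num))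
      simp only [] at e
      refine ⟨N + 1, fun k => Nat.casesOn k (if n % 2 = 1 then (m : ℝ) else 0) l, ?_, ?_⟩
      · rintro (_ | k)
        · by_cases h : n % 2 = 1 <;> simp [h]
        · exact hl k
      · rw [Finset.sum_range_succ']
        have e2 : ∑ k ∈ Finset.range (N + 1), (4 : ℝ) ^ (k + 1) * l k = 4 * ((m * spread (n / 2) : ℕ) : ℝ) := by
          rw [e, Finset.mul_sum]
          exact Finset.sum_congr rfl fun k _ => by ring
        simp only []
        rw [e2]
        rcases Nat.mod_two_eq_zero_or_one n with h | h
        · have h' : n = 2 * (n / 2) := by omega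
          conv_lhs => rw [h', spread_two_mul]
          simp [h]; ring
        · have h' : n = 2 * (n / 2) + 1 := by omega
          conv_lhs => rw [h', spread_two_mul_add_one]
          simp [h]; ring

/-- If the lowest digits differ, the difference is odd and the transform vanishes; if they agree,
the difference is `4` times one with smaller indices. -/
lemma cantorFT_spread_sub {m : ℕ} (hm : Odd m) (a b : ℕ) (hab : a ≠ b) :
    cantorFT (((m * spread a : ℤ) - (m * spread b : ℤ) : ℤ) : ℝ) = 0 := by
  induction hN : a + b using Nat.strong_induction_on generalizing a b with
  | _ N ih =>
    have hm' : Odd (m : ℤ) := by exact_mod_cast hm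
    obtain ⟨m', hm'⟩ := hm'
    rcases Nat.even_or_odd' a with ⟨a', rfl | rfl⟩ <;> rcases Nat.even_or_odd' b with ⟨b', rfl | rfl⟩
    · have := cantorFT_four_mul (ih (a' + b') (by omega) a' b' (by omega) rfl)
      convert this using 3
      simp only [spread_two_mul]; push_cast; ring
    · apply cantorFT_odd
      rw [spread_two_mul, spread_two_mul_add_one]
      refine ⟨2 * m * spread a' - 2 * m * spread b' - m' - 1, ?_⟩
      push_cast
      linear_combination (-1) * hm'
    · apply cantorFT_odd
      rw [spread_two_mul, spread_two_mul_add_one]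
      refine ⟨2 * m * spread a' - 2 * m * spread b' + m', ?_⟩
      push_cast
      linear_combination hm'
    · have := cantorFT_four_mul (ih (a' + b') (by omega) a' b' (by omega) rfl)
      convert this using 3
      simp only [spread_two_mul_add_one]; push_cast; ring

lemma orthonormal_expL2 {m : ℕ} (hm : Odd m) :
    Orthonormal ℂ fun n : ℕ => expL2 ((m * spread n : ℕ) : ℝ) := by
  refine ⟨fun n => norm_expL2 _, fun a b hab => ?_⟩
  change inner ℂ (expL2 _) (expL2 _) = 0
  rw [inner_expL2]
  have := cantorFT_spread_sub hm b a hab.symm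
  push_cast at this ⊢
  exact this

/-! ### Totality of the exponentials and Parseval on a closed span -/

lemma ae_zero_of_fourier_eq_zero_real {μ : Measure ℝ} [IsFiniteMeasure μ] {u : ℝ → ℝ}
    (hu : Integrable u μ)
    (h : ∀ t : ℝ, ∫ x, Complex.exp (t * x * Complex.I) * (u x : ℂ) ∂μ = 0) : u =ᵐ[μ] 0 := by
  wlog hm : Measurable u generalizing u
  · obtain ⟨v, hv, huv⟩ := hu.aestronglyMeasurable.aemeasurable
    refine huv.trans (this (hu.congr huv) (fun t => ?_) hv)
    rw [← h t]
    refine integral_congr_ae ?_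
    filter_upwards [huv] with x hx
    rw [hx]
  have key : ∀ v : ℝ → ℝ, Measurable v → ∀ t : ℝ,
      charFun (μ.withDensity fun x => ENNReal.ofReal (v x)) t =
        ∫ x, Complex.exp (t * x * Complex.I) * (max (v x) 0 : ℝ) ∂μ := by
    intro v hv t
    rw [charFun_apply_real, integral_withDensity_eq_integral_toReal_smul hv.ennreal_ofReal
      (Filter.Eventually.of_forall fun x => ENNReal.ofReal_lt_top)]
    congr 1
    ext x
    rw [ENNReal.toReal_ofReal', Complex.real_smul, mul_comm]
  have hexp : ∀ (t : ℝ) {v : ℝ → ℝ}, Integrable v μ →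
      Integrable (fun x : ℝ => Complex.exp (t * x * Complex.I) * (v x : ℂ)) μ := by
    intro t v hv
    refine hv.ofReal.bdd_mul (c := 1) (by fun_prop) (Filter.Eventually.of_forall fun x => ?_)
    have := Complex.norm_exp_ofReal_mul_I (t * x)
    push_cast at this
    exact this.le
  have hfin : ∀ v : ℝ → ℝ, Integrable v μ →
      ∫⁻ x, ENNReal.ofReal (v x) ∂μ ≠ ⊤ := fun v hv => hv.lintegral_lt_top.ne
  have h1 : IsFiniteMeasure (μ.withDensity fun x => ENNReal.ofReal (u x)) :=
    isFiniteMeasure_withDensity (hfin _ hu)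
  have h2 : IsFiniteMeasure (μ.withDensity fun x => ENNReal.ofReal (-u x)) :=
    isFiniteMeasure_withDensity (hfin _ hu.neg)
  -- The positive and negative parts of `u` are densities of finite measures with the same
  -- characteristic function.
  have heq : (μ.withDensity fun x => ENNReal.ofReal (u x)) =
      μ.withDensity fun x => ENNReal.ofReal (-u x) := by
    refine Measure.ext_of_charFun (funext fun t => ?_)
    rw [key u hm, key (fun x => -u x) hm.neg, ← sub_eq_zero, ← integral_sub (hexp t hu.pos_part)
      (hexp t hu.neg_part), ← h t]
    congr 1
    ext x
    rw [← mul_sub, ← Complex.ofReal_sub]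
    congr 2
    rcases le_total (u x) 0 with h | h
    · rw [max_eq_right h, max_eq_left (by simpa using h)]; ring
    · rw [max_eq_left h, max_eq_right (by simpa using h)]; ring
  have hm' : Measurable fun x => -u x := hm.neg
  rw [withDensity_eq_iff hm.ennreal_ofReal.aemeasurable hm'.ennreal_ofReal.aemeasurable
    (hfin _ hu)] at heq
  filter_upwards [heq] with x hx
  by_contra hne
  rcases lt_or_gt_of_ne hne with h | h
  · rw [ENNReal.ofReal_of_nonpos h.le, eq_comm, ENNReal.ofReal_eq_zero] at hx
    simp only [Pi.zero_apply] at h; linarith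
  · have h' : -u x ≤ 0 := by simpa using h.le
    rw [ENNReal.ofReal_of_nonpos h', ENNReal.ofReal_eq_zero] at hx
    simp only [Pi.zero_apply] at h; linarith

/-- The exponentials are total in `L²(μ)`. -/
lemma eq_zero_of_inner_expL2_eq_zero {g : Lp ℂ 2 cantorMeasure}
    (h : ∀ t, inner ℂ (expL2 t) g = 0) : g = 0 := by
  have hg : Integrable g cantorMeasure := (Lp.memLp g).integrable (by norm_num)
  have h0 : ∀ t : ℝ, ∫ x, Complex.exp (t * x * Complex.I) * g x ∂cantorMeasure = 0 := by
    intro t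
    rw [← h (-t / (2 * Real.pi)), L2.inner_def]
    refine integral_congr_ae ?_
    filter_upwards [expL2_ae (-t / (2 * Real.pi))] with x hx
    rw [hx, RCLike.inner_apply, ← Complex.exp_conj, mul_comm]
    congr 2
    simp only [map_mul, Complex.conj_ofReal, Complex.conj_I, map_ofNat]
    have := Real.pi_ne_zero
    push_cast
    field_simp
  have hexp : ∀ t : ℝ,
      Integrable (fun x : ℝ => Complex.exp (t * x * Complex.I) * g x) cantorMeasure := by
    intro t
    refine hg.bdd_mul (c := 1) (by fun_prop) (Filter.Eventually.of_forall fun x => ?_)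
    have := Complex.norm_exp_ofReal_mul_I (t * x)
    push_cast at this
    exact this.le
  have h0' : ∀ t : ℝ,
      ∫ x, Complex.exp (t * x * Complex.I) * (starRingEnd ℂ) (g x) ∂cantorMeasure = 0 := by
    intro t
    rw [← map_zero (starRingEnd ℂ), ← h0 (-t), ← integral_conj]
    congr 1
    ext x
    rw [map_mul, ← Complex.exp_conj]
    simp
  have hc : Integrable (fun x => (starRingEnd ℂ) (g x)) cantorMeasure :=
    (Complex.conjCLE.integrable_comp_iff).2 hg
  have hexp' : ∀ t : ℝ,
      Integrable (fun x : ℝ => Complex.exp (t * x * Complex.I) * (starRingEnd ℂ) (g x))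
        cantorMeasure := by
    intro t
    refine hc.bdd_mul (c := 1) (by fun_prop) (Filter.Eventually.of_forall fun x => ?_)
    have := Complex.norm_exp_ofReal_mul_I (t * x)
    push_cast at this
    exact this.le
  have hre := ae_zero_of_fourier_eq_zero_real (u := fun x => (g x).re) hg.re fun t => by
    have e : ∀ x : ℝ, Complex.exp (t * x * Complex.I) * ((g x).re : ℂ) =
        (1 / 2) * (Complex.exp (t * x * Complex.I) * g x +
          Complex.exp (t * x * Complex.I) * (starRingEnd ℂ) (g x)) := fun x => by
      rw [Complex.re_eq_add_conj]; ring
    simp_rw [e]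
    rw [integral_const_mul, integral_add (hexp t) (hexp' t), h0, h0', add_zero, mul_zero]
  have him := ae_zero_of_fourier_eq_zero_real (u := fun x => (g x).im) hg.im fun t => by
    have e : ∀ x : ℝ, Complex.exp (t * x * Complex.I) * ((g x).im : ℂ) =
        (1 / (2 * Complex.I)) * (Complex.exp (t * x * Complex.I) * g x -
          Complex.exp (t * x * Complex.I) * (starRingEnd ℂ) (g x)) := fun x => by
      rw [Complex.im_eq_sub_conj]; ring
    simp_rw [e]
    rw [integral_const_mul, integral_sub (hexp t) (hexp' t), h0, h0', sub_zero, mul_zero]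
  refine (Lp.eq_zero_iff_ae_eq_zero).2 ?_
  filter_upwards [hre, him] with x h1 h2
  exact Complex.ext h1 h2

/-- The family is a Hilbert basis of its own closed span `U`, so this is Parseval in `U` for the
projection of `x`. -/
lemma hasSum_norm_inner_sq {ι H : Type*} [NormedAddCommGroup H] [InnerProductSpace ℂ H]
    [CompleteSpace H] {v : ι → H} (hv : Orthonormal ℂ v) (x : H) :
    HasSum (fun i => ‖inner ℂ (v i) x‖ ^ 2)
      (‖(Submodule.span ℂ (Set.range v)).topologicalClosure.starProjection x‖ ^ 2) := by
  set U := (Submodule.span ℂ (Set.range v)).topologicalClosure with hU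
  have hmem : ∀ i, v i ∈ U := fun i =>
    Submodule.le_topologicalClosure _ (Submodule.subset_span ⟨i, rfl⟩)
  set v' : ι → U := fun i => ⟨v i, hmem i⟩ with hv'
  have hon : Orthonormal ℂ v' := hv.codRestrict U hmem
  have hbot : (Submodule.span ℂ (Set.range v'))ᗮ = ⊥ := by
    rw [Submodule.eq_bot_iff]
    intro u hu
    have h1 : (u : H) ∈ Uᗮ := by
      have hUo : Uᗮ = (Submodule.span ℂ (Set.range v))ᗮ := Submodule.orthogonal_closure _
      refine hUo ▸ ?_
      rw [Submodule.mem_orthogonal] at hu ⊢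
      intro y hy
      induction hy using Submodule.span_induction with
      | mem y hy =>
        obtain ⟨i, rfl⟩ := hy
        exact hu _ (Submodule.subset_span ⟨i, rfl⟩)
      | zero => exact inner_zero_left _
      | add y z _ _ hy hz => rw [inner_add_left, hy, hz, add_zero]
      | smul c y _ hy => rw [inner_smul_left, hy, mul_zero]
    have h2 := (Submodule.mem_orthogonal _ _).1 h1 u u.2
    exact Subtype.ext (inner_self_eq_zero.1 h2)
  have hb := (HilbertBasis.mkOfOrthogonalEqBot hon hbot).hasSum_inner_mul_inner
    (U.orthogonalProjectionOnto x) (U.orthogonalProjectionOnto x)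
  rw [HilbertBasis.coe_mkOfOrthogonalEqBot] at hb
  have key : ∀ i, inner ℂ (v' i) (U.orthogonalProjectionOnto x) =
      inner ℂ (v i) x := by
    intro i
    rw [Submodule.coe_inner, ← Submodule.starProjection_apply,
      ← Submodule.inner_starProjection_left_eq_right]
    change inner ℂ (U.starProjection (v i)) x = _
    rw [Submodule.starProjection_eq_self_iff.2 (hmem i)]
  have hb' := (Complex.hasSum_iff _ _).1 hb |>.1
  rw [inner_self_eq_norm_sq_to_K] at hb'
  convert hb' using 1
  · ext i
    rw [← inner_conj_symm (U.orthogonalProjectionOnto x), key, mul_comm, Complex.mul_conj, Complex.normSq_eq_norm_sq,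
      Complex.ofReal_re]
  · rw [Submodule.starProjection_apply]
    norm_cast

/-- Frequencies in `Γ(m)` give a Hilbert basis as soon as they span all exponentials. -/
lemma isCompleteNumber_of_mem_closure {m : ℕ} (hm : Odd m)
    (h : ∀ t, expL2 t ∈ (Submodule.span ℂ
      (Set.range fun n : ℕ => expL2 ((m * spread n : ℕ) : ℝ))).topologicalClosure) :
    IsCompleteNumber m := by
  have hch : ∀ lam : Gam m, ∃ n : ℕ, ((m * spread n : ℕ) : ℝ) = lam := fun lam => by
    have := (Set.ext_iff.1 (Gam_eq_range m) lam).1 lam.2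
    exact this
  choose N hN using hch
  have hNinj : Function.Injective N := fun a b hab => Subtype.ext (by rw [← hN a, ← hN b, hab])
  have hv : Orthonormal ℂ fun lam : Gam m => expL2 lam := by
    have := (orthonormal_expL2 hm).comp N hNinj
    convert this using 1
    ext1 lam
    simp only [Function.comp, hN]
  have hrange : (Set.range fun lam : Gam m => expL2 lam) =
      Set.range fun n : ℕ => expL2 ((m * spread n : ℕ) : ℝ) := by
    ext y
    constructor
    · rintro ⟨lam, rfl⟩
      exact ⟨N lam, by simp only [hN]⟩
    · rintro ⟨n, rfl⟩
      exact ⟨⟨_, by rw [Gam_eq_range]; exact ⟨n, rfl⟩⟩, rfl⟩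
  refine ⟨HilbertBasis.mkOfOrthogonalEqBot hv ?_, fun lam => ?_⟩
  · rw [hrange, ← Submodule.orthogonal_closure, Submodule.eq_bot_iff]
    exact fun g hg => eq_zero_of_inner_expL2_eq_zero fun t =>
      (Submodule.mem_orthogonal _ _).1 hg _ (h t)
  · rw [HilbertBasis.coe_mkOfOrthogonalEqBot]
    exact expL2_ae lam

/-! ### No cycle implies complete -/

/-- The weight `|1 + e^{iπt}|² / 4` of a transition. -/
def weight (t : ℝ) : ℝ := (1 + Real.cos (Real.pi * t)) / 2

lemma weight_nonneg (t : ℝ) : 0 ≤ weight t := by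
  have := Real.neg_one_le_cos (Real.pi * t)
  unfold weight; linarith

lemma weight_add_odd (t : ℝ) {m : ℕ} (hm : Odd m) : weight (t + m) = 1 - weight t := by
  have : Real.cos (Real.pi * (t + m)) = -Real.cos (Real.pi * t) := by
    rw [mul_add, mul_comm Real.pi (m : ℝ), Real.cos_add_nat_mul_pi, hm.neg_one_pow, neg_one_mul]
  unfold weight
  rw [this]; ring

lemma weight_add_four_mul (t : ℝ) (k : ℕ) : weight (t + 4 * k) = weight t := by
  have : Real.pi * (t + 4 * k) = Real.pi * t + ((2 * k : ℕ) : ℝ) * (2 * Real.pi) := by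
    push_cast; ring
  unfold weight
  rw [this, Real.cos_add_nat_mul_two_pi]

lemma norm_cantorFT_sq (t : ℝ) : ‖cantorFT t‖ ^ 2 = weight t * ‖cantorFT (t / 4)‖ ^ 2 := by
  rw [cantorFT_eq, norm_mul, mul_pow]
  congr 1
  rw [← Complex.normSq_eq_norm_sq, map_div₀, Complex.normSq_apply]
  simp only [weight, Complex.normSq_ofNat, Complex.add_re, Complex.add_im, Complex.one_re,
    Complex.one_im, Complex.exp_ofReal_mul_I_re, Complex.exp_ofReal_mul_I_im]
  linear_combination (1 / 4) * Real.sin_sq_add_cos_sq (Real.pi * t)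

lemma exists_int_of_weight_eq_one {t : ℝ} (h : weight t = 1) : ∃ n : ℤ, t = 2 * n := by
  have h1 : Real.cos (Real.pi * t) = 1 := by unfold weight at h; linarith
  obtain ⟨n, hn⟩ := (Real.cos_eq_one_iff _).1 h1
  refine ⟨n, ?_⟩
  have := Real.pi_pos
  nlinarith

/-- A finite set in `(0, m / 3]` that is closed under the transitions of positive weight consists
of integers and is stable under multiplication by `4` modulo `m`. -/
lemma hasCycle_of_finite {m : ℕ} (hm : Odd m) {Z : Set ℝ} (hfin : Z.Finite) (hne : Z.Nonempty)
    (hZ : ∀ t ∈ Z, 0 < t ∧ 3 * t ≤ m) (h0 : ∀ t ∈ Z, 0 < weight t → t / 4 ∈ Z)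
    (h1 : ∀ t ∈ Z, 0 < weight (t + m) → (t + m) / 4 ∈ Z) : HasCycle m := by
  have hw : ∀ t, weight t = 0 → weight (t + m) = 1 := fun t ht => by
    rw [weight_add_odd t hm, ht, sub_zero]
  have hm0 : (0 : ℝ) < m := by exact_mod_cast hm.pos
  classical
  -- The two weights sum to `1`, so some transition is always allowed; `s` picks one, preferring `t
  -- / 4`.
  let s : Z → Z := fun t =>
    if h : 0 < weight t then ⟨t / 4, h0 t t.2 h⟩
    else ⟨(t + m) / 4, h1 t t.2 (by
      rw [hw t (le_antisymm (not_lt.1 h) (weight_nonneg _))]; exact one_pos)⟩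
  have hs0 : ∀ t : Z, 0 < weight t → (s t : ℝ) = t / 4 := fun t h => by simp only [s, dif_pos h]
  have hs1 : ∀ t : Z, ¬ 0 < weight t → (s t : ℝ) = (t + m) / 4 :=
    fun t h => by simp only [s, dif_neg h]
  -- The branches land in the disjoint intervals `(0, m / 12]` and `(m / 4, m / 3]`.
  have hinj : Function.Injective s := by
    intro a b hab
    have e : (s a : ℝ) = s b := by rw [hab]
    have ha := hZ a a.2
    have hb := hZ b b.2
    refine Subtype.ext ?_
    by_cases h : 0 < weight a <;> by_cases h' : 0 < weight b
    · rw [hs0 a h, hs0 b h'] at e; linarith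
    · rw [hs0 a h, hs1 b h'] at e; linarith
    · rw [hs1 a h, hs0 b h'] at e; linarith
    · rw [hs1 a h, hs1 b h'] at e; linarith
  have : Finite Z := hfin
  have hsurj := Finite.surjective_of_injective hinj
  -- Were both transitions allowed at `t`, surjectivity would make the unused target `(t + m) / 4` a
  -- value of `s`, which only `t` itself could attain. So transitions are deterministic, with
  -- weights `0` or `1`.
  have hone : ∀ t : Z, 0 < weight t → weight t = 1 := by
    intro t ht
    by_contra hne
    have hpos : 0 < weight (t + m) :=
      lt_of_le_of_ne (weight_nonneg _) fun h => hne (by rw [weight_add_odd _ hm] at h; linarith)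
    obtain ⟨a, ha⟩ := hsurj ⟨_, h1 t t.2 hpos⟩
    have e : (s a : ℝ) = (t + m) / 4 := by rw [ha]
    have ha := hZ a a.2
    have hb := hZ t t.2
    by_cases h : 0 < weight a
    · rw [hs0 a h] at e; linarith
    · rw [hs1 a h] at e
      have : a = t := Subtype.ext (by linarith)
      exact h (this ▸ ht)
  have hpre : ∀ y ∈ Z, ∃ t ∈ Z, (4 * y = t ∨ 4 * y = t + m) ∧ ∃ n : ℤ, 4 * y = 2 * n := by
    intro y hy
    obtain ⟨t, ht⟩ := hsurj ⟨y, hy⟩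
    have e : (s t : ℝ) = y := by rw [ht]
    refine ⟨t, t.2, ?_⟩
    by_cases h : 0 < weight t
    · rw [hs0 t h] at e
      have e' : 4 * y = t := by linarith
      exact ⟨Or.inl e', e' ▸ exists_int_of_weight_eq_one (hone t h)⟩
    · rw [hs1 t h] at e
      have e' : 4 * y = t + m := by linarith
      exact ⟨Or.inr e', e' ▸ exists_int_of_weight_eq_one
        (hw t (le_antisymm (not_lt.1 h) (weight_nonneg _)))⟩
  have hnat : ∀ t ∈ Z, ∃ n : ℕ, t = n := by
    intro t ht
    have hint : ∃ k : ℤ, t = k := by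
      obtain ⟨n, hn⟩ := (hpre _ (s ⟨t, ht⟩).2).choose_spec.2.2
      by_cases h : 0 < weight t
      · rw [hs0 ⟨t, ht⟩ h] at hn
        exact ⟨2 * n, by push_cast; linarith⟩
      · rw [hs1 ⟨t, ht⟩ h] at hn
        exact ⟨2 * n - m, by push_cast; linarith⟩
    obtain ⟨k, rfl⟩ := hint
    have := (hZ _ ht).1
    obtain ⟨n, rfl⟩ := Int.eq_ofNat_of_zero_le (Int.cast_pos.1 this).le
    exact ⟨n, by simp⟩
  -- Inverting `s` is multiplication by `4` modulo `m`.
  have hmul : ∀ y : ℕ, (y : ℝ) ∈ Z → ((4 * y % m : ℕ) : ℝ) ∈ Z := by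
    intro y hy
    obtain ⟨t, ht, hyt, -⟩ := hpre _ hy
    obtain ⟨n, rfl⟩ := hnat t ht
    have hn : 3 * n ≤ m := by exact_mod_cast (hZ _ ht).2
    have hn0 : 0 < n := by exact_mod_cast (hZ _ ht).1
    have e : 4 * y % m = n := by
      rcases hyt with h | h
      · have : 4 * y = n := by exact_mod_cast h
        rw [this, Nat.mod_eq_of_lt (by omega)]
      · have : 4 * y = n + m := by exact_mod_cast h
        rw [this, Nat.add_mod_right, Nat.mod_eq_of_lt (by omega)]
    rw [e]; exact ht
  obtain ⟨t, ht⟩ := hne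
  obtain ⟨x, rfl⟩ := hnat t ht
  have horb : ∀ j : ℕ, ((4 ^ j * x % m : ℕ) : ℝ) ∈ Z := by
    intro j
    induction j with
    | zero =>
      have hn : 3 * x ≤ m := by exact_mod_cast (hZ _ ht).2
      have hn0 : 0 < x := by exact_mod_cast (hZ _ ht).1
      rwa [pow_zero, one_mul, Nat.mod_eq_of_lt (by omega)]
    | succ j ih =>
      have := hmul _ ih
      rwa [Nat.mul_mod_mod, ← mul_assoc, ← pow_succ'] at this
  refine ⟨x, fun j => ?_⟩
  have := hZ _ (horb j)
  exact ⟨by exact_mod_cast this.1, by exact_mod_cast this.2⟩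

theorem isCompleteNumber_of_not_hasCycle {m : ℕ} (hm : Odd m) (hcyc : ¬ HasCycle m) :
    IsCompleteNumber m := by
  have hm0 : (0 : ℝ) < m := by exact_mod_cast hm.pos
  have hv := orthonormal_expL2 hm
  refine isCompleteNumber_of_mem_closure hm ?_
  set U := (Submodule.span ℂ
    (Set.range fun n : ℕ => expL2 ((m * spread n : ℕ) : ℝ))).topologicalClosure with hU
  -- The sign makes the frequencies add: the inner products become `μ̂(t + γ)`.
  set h : ℝ → ℝ := fun t => ‖U.starProjection (expL2 (-t))‖ ^ 2 with hh
  have hcd : ContDiff ℝ ⊤ h := by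
    refine ContDiff.norm_sq ℂ ?_
    exact (U.starProjection.restrictScalars ℝ).contDiff.comp (contDiff_expL2.comp contDiff_neg)
  have han : AnalyticOnNhd ℝ h Set.univ := contDiff_omega_iff_analyticOnNhd.1 hcd
  have hsum : ∀ t, HasSum (fun n : ℕ => ‖cantorFT (t + (m * spread n : ℕ))‖ ^ 2) (h t) := by
    intro t
    have := hasSum_norm_inner_sq hv (expL2 (-t))
    convert this using 2 with n
    rw [norm_inner_symm, inner_expL2, sub_neg_eq_add, add_comm]
  -- Split the sum over `Γ(m)` by the lowest digit, that is, by the parity of the index.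
  have hharm : ∀ t, h t = weight t * h (t / 4) + weight (t + m) * h ((t + m) / 4) := by
    intro t
    have h0 := (hsum (t / 4)).mul_left (weight t)
    have h1 := (hsum ((t + m) / 4)).mul_left (weight (t + m))
    refine (hsum t).unique (HasSum.even_add_odd ?_ ?_)
    · refine Eq.mpr (congrArg (HasSum · _) (funext fun n => ?_)) h0
      rw [norm_cantorFT_sq, spread_two_mul]
      have e : t + ((m * (4 * spread n) : ℕ) : ℝ) = t + 4 * ((m * spread n : ℕ) : ℝ) := by
        push_cast; ring
      rw [e, weight_add_four_mul, add_div, mul_div_cancel_left₀ _ (by norm_num : (4 : ℝ) ≠ 0)]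
    · refine Eq.mpr (congrArg (HasSum · _) (funext fun n => ?_)) h1
      rw [norm_cantorFT_sq, spread_two_mul_add_one]
      have e : t + ((m * (4 * spread n + 1) : ℕ) : ℝ) =
          t + m + 4 * ((m * spread n : ℕ) : ℝ) := by
        push_cast; ring
      rw [e, weight_add_four_mul, add_div _ (4 * _),
        mul_div_cancel_left₀ _ (by norm_num : (4 : ℝ) ≠ 0)]
  have h_zero : h 0 = 1 := by
    have hmem : expL2 (-0) ∈ U := by
      refine Submodule.le_topologicalClosure _ (Submodule.subset_span ⟨0, ?_⟩)
      simp [spread_zero]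
    simp only [hh]
    rw [Submodule.norm_starProjection_apply _ hmem, norm_expL2, one_pow]
  suffices hone : ∀ t, h t = 1 by
    intro t
    have := hone (-t)
    simp only [hh, neg_neg] at this
    rw [Submodule.mem_iff_norm_starProjection, norm_expL2]
    exact (pow_eq_one_iff_of_nonneg (norm_nonneg _) two_ne_zero).1 this
  -- The endpoints are the fixed points of `t / 4` and `(t + m) / 4`, so both maps preserve `I`.
  set I : Set ℝ := Set.Icc 0 (m / 3) with hI
  have h0I : (0 : ℝ) ∈ I := ⟨le_rfl, by positivity⟩
  obtain ⟨t₀, ht₀, hmin⟩ := (isCompact_Icc (a := (0 : ℝ)) (b := m / 3)).exists_isMinOn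
    ⟨0, h0I⟩ hcd.continuous.continuousOn
  have hmin' : ∀ t ∈ I, h t₀ ≤ h t := fun t ht => hmin ht
  have hmove0 : ∀ t ∈ I, t / 4 ∈ I := fun t ht => ⟨by linarith [ht.1], by linarith [ht.2, ht.1]⟩
  have hmove1 : ∀ t ∈ I, (t + m) / 4 ∈ I := fun t ht =>
    ⟨by linarith [ht.1], by linarith [ht.2, ht.1]⟩
  set Z : Set ℝ := {t ∈ I | h t = h t₀} with hZ
  have hinf : ∀ c : ℝ, {t ∈ I | h t = c}.Infinite → ∀ t, h t = c := by
    intro c hc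
    obtain ⟨x, -, hx⟩ := hc.exists_accPt_of_subset_isCompact isCompact_Icc (Set.sep_subset _ _)
    rw [accPt_iff_frequently_nhdsNE] at hx
    have := han.eq_of_frequently_eq (g := fun _ => c) analyticOnNhd_const
      (hx.mono fun y hy => hy.2)
    exact fun t => congrFun this t
  by_cases hfin : Z.Finite
  swap
  · intro t
    have := hinf _ hfin
    rw [this t, ← this 0, h_zero]
  exfalso
  refine hcyc (hasCycle_of_finite hm hfin ⟨t₀, ht₀, rfl⟩ ?_ ?_ ?_)
  · intro t ht
    refine ⟨lt_of_le_of_ne ht.1.1 ?_, by linarith [ht.1.2]⟩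
    rintro rfl
    have hle : ∀ t, h t ≤ 1 := fun t =>
      pow_le_one₀ (norm_nonneg _) ((U.norm_starProjection_apply_le _).trans_eq (norm_expL2 _))
    -- If `0` were a minimizer, the minimum would equal the upper bound `1`, making all of `I`
    -- minimizers.
    have hsub : I ⊆ Z := fun t ht' =>
      ⟨ht', le_antisymm (by rw [← ht.2, h_zero]; exact hle t) (hmin' t ht')⟩
    exact (Set.Icc_infinite (by positivity)) (hfin.subset hsub)
  · intro t ht hw
    refine ⟨hmove0 t ht.1, ?_⟩
    have e := hharm t
    rw [ht.2] at e
    have a := hmin' _ (hmove0 t ht.1)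
    have b := mul_le_mul_of_nonneg_left (hmin' _ (hmove1 t ht.1)) (weight_nonneg (t + m))
    rw [weight_add_odd t hm] at e b
    exact le_antisymm (le_of_mul_le_mul_left (by linarith) hw) a
  · intro t ht hw
    refine ⟨hmove1 t ht.1, ?_⟩
    have e := hharm t
    rw [ht.2] at e
    have a := hmin' _ (hmove1 t ht.1)
    have b := mul_le_mul_of_nonneg_left (hmin' _ (hmove0 t ht.1)) (weight_nonneg t)
    have e2 : weight t = 1 - weight (t + m) := by rw [weight_add_odd t hm]; ring
    rw [e2] at e b
    exact le_antisymm (le_of_mul_le_mul_left (by linarith) hw) a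

/-! ### A cycle implies incomplete -/

lemma cantorFT_cycle_add {m : ℕ} (hm : Odd m) {x : ℕ}
    (hx : ∀ j : ℕ, 0 < 4 ^ j * x % m ∧ 3 * (4 ^ j * x % m) ≤ m) (j n : ℕ) :
    cantorFT (((4 ^ j * x % m : ℕ) + (m * spread n : ℕ) : ℤ) : ℝ) = 0 := by
  induction hN : 4 ^ j * x % m + m * spread n using Nat.strong_induction_on generalizing j n with
  | _ N ih =>
    obtain ⟨o, ho⟩ : ∃ o, o4 m = o + 1 := ⟨_, (Nat.succ_pred_eq_of_pos (o4_pos hm)).symm⟩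
    -- Going `o4 m - 1` steps forward reaches the predecessor `z` of the cycle point `y`.
    have hmod : 4 * (4 ^ (j + o) * x % m) % m = 4 ^ j * x % m := by
      have h4 : 4 ^ o4 m ≡ 1 [MOD m] :=
        ((Nat.modEq_iff_dvd' (one_le_four_pow _)).2 (dvd_four_pow_o4_sub_one m)).symm
      rw [Nat.mul_mod_mod]
      have e : 4 * (4 ^ (j + o) * x) = 4 ^ o4 m * (4 ^ j * x) := by rw [ho]; ring
      rw [e]
      have := h4.mul_right (4 ^ j * x)
      rwa [one_mul] at this
    obtain ⟨hy0, -⟩ := hx j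
    obtain ⟨hz0, hz⟩ := hx (j + o)
    have ih' := fun n' hlt => ih _ hlt (j + o) n' rfl
    generalize 4 ^ j * x % m = y at *
    generalize 4 ^ (j + o) * x % m = z at *
    -- The bound `3 * z ≤ m` leaves at most one reduction by `m`. Exactly one lowest digit then
    -- makes the frequency `4` times a smaller one of the same form; the other digit makes it odd.
    have hcase : 4 * z = y ∨ 4 * z = y + m := by
      have hd := Nat.div_add_mod (4 * z) m
      have hq : 4 * z / m < 2 := Nat.div_lt_of_lt_mul (by omega)
      rw [hmod] at hd
      generalize 4 * z / m = q at *
      interval_cases q <;> omega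
    obtain ⟨k, hk⟩ := hm
    have hkZ : (m : ℤ) = 2 * k + 1 := by exact_mod_cast hk
    rcases Nat.even_or_odd' n with ⟨n', rfl | rfl⟩ <;> rcases hcase with hc | hc <;>
      have hcZ := congrArg (Nat.cast (R := ℤ)) hc <;> push_cast at hcZ
    · rw [spread_two_mul] at hN ⊢
      have e : m * (4 * spread n') = 4 * (m * spread n') := by ring
      have := cantorFT_four_mul (ih' n' (by omega))
      convert this using 3
      push_cast
      linear_combination (-1) * hcZ
    · rw [spread_two_mul]
      refine cantorFT_odd ⟨2 * z + 2 * m * spread n' - k - 1, ?_⟩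
      push_cast
      linear_combination (-1) * hcZ - hkZ
    · rw [spread_two_mul_add_one]
      refine cantorFT_odd ⟨2 * z + 2 * m * spread n' + k, ?_⟩
      push_cast
      linear_combination (-1) * hcZ + hkZ
    · rw [spread_two_mul_add_one] at hN ⊢
      have e : m * (4 * spread n' + 1) = 4 * (m * spread n') + m := by ring
      have := cantorFT_four_mul (ih' n' (by omega))
      convert this using 3
      push_cast
      linear_combination (-1) * hcZ

theorem not_isCompleteNumber_of_hasCycle {m : ℕ} (hm : Odd m) (h : HasCycle m) :
    ¬ IsCompleteNumber m := by
  rintro ⟨b, hb⟩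
  obtain ⟨x, hx⟩ := h
  have hb' : ∀ lam : Gam m, b lam = expL2 lam := fun lam =>
    Lp.ext ((hb lam).trans (expL2_ae lam).symm)
  set g := expL2 (-((x % m : ℕ) : ℝ)) with hg
  have horth : ∀ lam, inner ℂ g (b lam) = 0 := by
    intro lam
    obtain ⟨n, hn⟩ := (Set.ext_iff.1 (Gam_eq_range m) lam).1 lam.2
    rw [hb', hg, inner_expL2, ← hn]
    have := cantorFT_cycle_add hm hx 0 n
    rw [pow_zero, one_mul] at this
    push_cast at this ⊢
    rw [sub_neg_eq_add, add_comm]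
    exact this
  -- Parseval for the supposed basis forces the unit vector `g` to vanish.
  have hsum := b.tsum_inner_mul_inner g g
  simp only [horth, zero_mul, tsum_zero] at hsum
  have h0 : g = 0 := inner_self_eq_zero.1 hsum.symm
  have := norm_expL2 (-((x % m : ℕ) : ℝ))
  rw [← hg, h0, norm_zero] at this
  exact zero_ne_one this

end CantorFourier

end

theorem theorem3p8 (r : ℕ) (p : Fin r → ℕ) (hp : ∀ i, (p i).Prime) (hodd : ∀ i, Odd (p i))
    (hinj : Function.Injective p)
    (j : Fin r → ℕ)
    (hj : ∀ i, IsGreatest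
      {n : ℕ | p i ^ n ∣ Finset.univ.lcm fun i' => CantorFourier.o4 (p i')} (j i))
    (hcomplete : CantorFourier.IsCompleteNumber
      (∏ i, p i ^ (CantorFourier.iota4 (p i) + j i)))
    (k : Fin r → ℕ) :
    CantorFourier.IsCompleteNumber (∏ i, p i ^ k i) := by
  have hoddprod : ∀ e : Fin r → ℕ, Odd (∏ i, p i ^ e i) := fun e =>
    Finset.prod_induction _ Odd (fun _ _ => Odd.mul) odd_one fun i _ => (hodd i).pow
  exact CantorFourier.isCompleteNumber_of_not_hasCycle (hoddprod k) fun h =>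
    CantorFourier.not_isCompleteNumber_of_hasCycle (hoddprod _) (h.prod_pow hp hodd hj) hcomplete
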